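/- A \emph{type} is a pair $\mathsf A=(\alpha,K)$ of a (strictly) linearly ordered set $\alpha$ and a set $K$ of constant symbols (not containing $0,1$). An \emph{$\mathsf A$-algebra} is a Boolean algebra $\mathfrak A$ with a unary operation $\Diamond_i$ for each $i\in\alpha$ and a distinguished element $c^{\mathfrak A}$ for each $c\in K$, such that, with $\Box_i x=\overline{\Diamond_i\overline{x}}$, for all $x,y\in\mathfrak A$ and all $i\in\alpha$: $\Diamond_i0=0$, $\Diamond_i x\vee\Diamond_i y=\Diamond_i(x\vee y)$, $\Diamond_i(\overline{\Diamond_i x}\wedge x)=\Diamond_i x$, and, for $i<j$ in $\alpha$, $\Diamond_j x\le\Diamond_i x$ and $\Diamond_i x\le\Box_j\Diamond_i x$. Homomorphisms preserve all operations and constants. For $i\in\alpha$ put $$x\vartriangleleft_i y\iff y\le\Diamond_i x,\qquad x\equiv_i y\iff \Diamond_i x\vee x=\Diamond_i y\vee y .$$ The algebra $\mathfrak A$ is \emph{linear} if $\bigcup_{i\in\alpha}(\vartriangleleft_i\cup\equiv_i)$ is a linear (i.e. total) preorder on $\mathfrak A$ and $\bigcup_{i\in\alpha}\vartriangleleft_i\,\cap\,\bigcup_{i\in\alpha}\equiv_i\;=\{(0,0)\}$.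 A \emph{type embedding} $l\colon(\alpha,K)\to(\beta,L)$ consists of a strictly monotone map $f\colon\alpha\to\beta$ and an injection $g\colon K\to L$. It is \emph{final} if $\alpha$ has a least element, $g$ is a bijection, and $f(\alpha)$ is a final interval (upward closed subset) of $\beta$. For a $(\beta,L)$-algebra $\mathfrak C$ its \emph{$l$-puration} $P^l(\mathfrak C)$ is the $(\alpha,K)$-algebra with the same underlying Boolean algebra in which $\Diamond_i$ is interpreted as $\Diamond_{f(i)}^{\mathfrak C}$ and $c$ as $g(c)^{\mathfrak C}$. A \emph{free $l$-extension} of an $(\alpha,K)$-algebra $\mathfrak A$ is a $(\beta,L)$-algebra $F^l(\mathfrak A)$ with a homomorphism $e\colon\mathfrak A\to P^l(F^l(\mathfrak A))$ such that for every $(\beta,L)$-algebra $\mathfrak C$ and every homomorphism $h_0\colon\mathfrak A\to P^l(\mathfrak C)$ there is a unique homomorphism $h\colon F^l(\mathfrak A)\to\mathfrak C$ with $h\circ e=h_0$ as maps; it exists and is unique up to isomorphism. \textbf{Lemma.} Let $l\colon\mathsf A\to\mathsf B$ be a final type embedding and let $\mathfrak A$ be a linear $\mathsf A$-algebra. Then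 the free $l$-extension $F^l(\mathfrak A)$ is linear. Moreover, for every nonempty linearly ordered set $\alpha$, the free $\emptyset$-generated $\mathsf{GLP}_\alpha$-algebra (the $(\alpha,\emptyset)$-algebra that has exactly one homomorphism to every $(\alpha,\emptyset)$-algebra) is linear. -/

import Mathlib

universe u v w x

/-- `X` is a GLP-algebra of the type `(α, K)`: a Boolean algebra with an operator `◇ i` for every
element `i` of the linear order `α` and a distinguished element for every constant symbol in `K`.
The symbols `⊥`, `⊤` are not among the constant symbols. -/
class GLPAlgebra (α : Type*) (K : Type*) [LinearOrder α] (X : Type*) [BooleanAlgebra X] where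
  /-- the operators `◇ i` -/
  dia : α → X → X
  /-- the interpretation of the constant symbols -/
  const : K → X
  dia_bot : ∀ i, dia i ⊥ = ⊥
  dia_sup : ∀ i x y, dia i x ⊔ dia i y = dia i (x ⊔ y)
  dia_loeb : ∀ i x, dia i ((dia i x)ᶜ ⊓ x) = dia i x
  dia_anti : ∀ i j x, i < j → dia j x ≤ dia i x
  /-- `◇ i x ≤ □ j (◇ i x)`, where `□ j y = (◇ j yᶜ)ᶜ` -/
  dia_le_box_dia : ∀ i j x, i < j → dia i x ≤ (dia j (dia i x)ᶜ)ᶜ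

/-- Homomorphisms of GLP-algebras of the type `(α, K)`. (Homomorphisms of bounded lattices between
Boolean algebras preserve complements.) -/
structure GLPHom (α : Type*) (K : Type*) [LinearOrder α] (X Y : Type*) [BooleanAlgebra X]
    [BooleanAlgebra Y] [GLPAlgebra α K X] [GLPAlgebra α K Y] extends BoundedLatticeHom X Y where
  map_dia' : ∀ (i : α) (x : X),
    toFun (GLPAlgebra.dia K i x) = GLPAlgebra.dia K i (toFun x)
  map_const' : ∀ c : K, toFun (GLPAlgebra.const α c) = GLPAlgebra.const α c

/-- Type embeddings `(α, K) → (β, L)`. -/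
structure TypeEmbedding (α : Type*) (K : Type*) (β : Type*) (L : Type*)
    [LinearOrder α] [LinearOrder β] where
  /-- the map of the operator indices -/
  idx : α → β
  /-- the map of the constant symbols -/
  cst : K → L
  strictMono_idx : StrictMono idx
  injective_cst : Function.Injective cst

/-- A type embedding is final if the index set of its domain has a least element, it is a bijection
on constant symbols, and it maps the indices onto a final interval. -/
structure TypeEmbedding.IsFinal {α K β L : Type*} [LinearOrder α] [LinearOrder β]
    (l : TypeEmbedding α K β L) : Prop where
  normal : ∃ m : α, IsBot m
  bijective_cst : Function.Bijective l.cst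
  isUpperSet_range : IsUpperSet (Set.range l.idx)

/-- The `l`-puration of an algebra `X` of the type `(β, L)`: the same Boolean algebra, regarded as
an algebra of the type `(α, K)` by interpreting each symbol `s` as `l s` is interpreted in `X`. -/
def Puration {α K β L : Type*} [LinearOrder α] [LinearOrder β]
    (_l : TypeEmbedding α K β L) (X : Type x) : Type x := X

section Puration

variable {α K β L : Type*} [LinearOrder α] [LinearOrder β] (l : TypeEmbedding α K β L)

instance (X : Type*) [BooleanAlgebra X] : BooleanAlgebra (Puration l X) :=
  inferInstanceAs (BooleanAlgebra X)

instance (X : Type*) [BooleanAlgebra X] [GLPAlgebra β L X] : GLPAlgebra α K (Puration l X) where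
  dia i := (GLPAlgebra.dia L (l.idx i) : X → X)
  const c := (GLPAlgebra.const β (l.cst c) : X)
  dia_bot i := GLPAlgebra.dia_bot (K := L) (X := X) (l.idx i)
  dia_sup i := GLPAlgebra.dia_sup (K := L) (X := X) (l.idx i)
  dia_loeb i := GLPAlgebra.dia_loeb (K := L) (X := X) (l.idx i)
  dia_anti i j y h :=
    GLPAlgebra.dia_anti (K := L) (X := X) (l.idx i) (l.idx j) y (l.strictMono_idx h)
  dia_le_box_dia i j y h :=
    GLPAlgebra.dia_le_box_dia (K := L) (X := X) (l.idx i) (l.idx j) y (l.strictMono_idx h)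

/-- The action of the puration on homomorphisms: the same function. -/
def Puration.map {X Y : Type*} [BooleanAlgebra X] [BooleanAlgebra Y] [GLPAlgebra β L X]
    [GLPAlgebra β L Y] (h : GLPHom β L X Y) :
    GLPHom α K (Puration l X) (Puration l Y) where
  toFun := h.toFun
  map_sup' := h.map_sup'
  map_inf' := h.map_inf'
  map_top' := h.map_top'
  map_bot' := h.map_bot'
  map_dia' i := h.map_dia' (l.idx i)
  map_const' c := h.map_const' (l.cst c)

end Puration

/-- `(F, e)` is a free `l`-extension of the algebra `A` of the type `(α, K)`: for every
homomorphism `g` from `A` to the `l`-puration of an algebra `C` there is exactly one homomorphism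
`h : F → C` whose `l`-puration takes `e` to `g`. Here `C` ranges over the universe of `F`, so that
`F` has to be taken in a universe that contains `β`, `L` and `A`. -/
def IsFreeExtension {α K β L : Type*} [LinearOrder α] [LinearOrder β]
    (l : TypeEmbedding α K β L) {A : Type*} [BooleanAlgebra A] [GLPAlgebra α K A]
    {F : Type x} [BooleanAlgebra F] [GLPAlgebra β L F]
    (e : GLPHom α K A (Puration l F)) : Prop :=
  ∀ (C : Type x) [BooleanAlgebra C] [GLPAlgebra β L C] (g : GLPHom α K A (Puration l C)),
    ∃! h : GLPHom β L F C, ∀ a : A, (Puration.map l h).toFun (e.toFun a) = g.toFun a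

/-- `F` is a free `GLP_α`-algebra (no constant symbols) with the family `e` of free generators. -/
def IsFreeGLPAlgebra (α : Type*) [LinearOrder α] {S : Type*}
    {F : Type x} [BooleanAlgebra F] [GLPAlgebra α Empty F] (e : S → F) : Prop :=
  ∀ (C : Type x) [BooleanAlgebra C] [GLPAlgebra α Empty C] (g : S → C),
    ∃! h : GLPHom α Empty F C, ∀ s : S, h.toFun (e s) = g s

section Linear

variable (α K : Type*) [LinearOrder α] {X : Type*} [BooleanAlgebra X] [GLPAlgebra α K X]

variable {α} in
/-- The relation `x ⊲ᵢ y`. -/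
def GLPAlgebra.Tri (i : α) (x y : X) : Prop := y ≤ GLPAlgebra.dia K i x

variable {α} in
/-- The relation `x ≡ᵢ y`. -/
def GLPAlgebra.Sim (i : α) (x y : X) : Prop :=
  GLPAlgebra.dia K i x ⊔ x = GLPAlgebra.dia K i y ⊔ y

/-- The union of the relations `⊲ᵢ ∪ ≡ᵢ` over all indices `i`. -/
def GLPAlgebra.Rel (x y : X) : Prop :=
  ∃ i : α, GLPAlgebra.Tri K i x y ∨ GLPAlgebra.Sim K i x y

variable (X) in
/-- Linear algebras: the union of all `⊲ᵢ` and `≡ᵢ` is a linear (that is, total) preorder, and the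
union of the `⊲ᵢ` meets the union of the `≡ᵢ` in the pair `(⊥, ⊥)` only. -/
structure GLPAlgebra.IsLinear : Prop where
  refl : ∀ x : X, GLPAlgebra.Rel α K x x
  trans : ∀ x y z : X,
    GLPAlgebra.Rel α K x y → GLPAlgebra.Rel α K y z → GLPAlgebra.Rel α K x z
  total : ∀ x y : X, GLPAlgebra.Rel α K x y ∨ GLPAlgebra.Rel α K y x
  inter : (⋃ i : α, {p : X × X | GLPAlgebra.Tri K i p.1 p.2}) ∩
    (⋃ i : α, {p : X × X | GLPAlgebra.Sim K i p.1 p.2}) = {(⊥, ⊥)}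

end Linear

/-! Free extensions and free algebras exist: they are built from terms, two terms being identified
if they have the same value under all admissible valuations. -/

/-- Terms of the type `(β, L)` with variables in `S`. -/
inductive GLPTerm (β : Type*) (L : Type*) (S : Type*)
  | gen (s : S)
  | cst (c : L)
  | bot
  | top
  | inf (t₁ t₂ : GLPTerm β L S)
  | sup (t₁ t₂ : GLPTerm β L S)
  | compl (t : GLPTerm β L S)
  | dia (i : β) (t : GLPTerm β L S)

/-- The value of a term under a valuation of its variables. -/
def GLPTerm.eval {β L S : Type*} [LinearOrder β] {C : Type*} [BooleanAlgebra C]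
    [GLPAlgebra β L C] (e : S → C) : GLPTerm β L S → C
  | .gen s => e s
  | .cst c => GLPAlgebra.const β c
  | .bot => ⊥
  | .top => ⊤
  | .inf t₁ t₂ => t₁.eval e ⊓ t₂.eval e
  | .sup t₁ t₂ => t₁.eval e ⊔ t₂.eval e
  | .compl t => (t.eval e)ᶜ
  | .dia i t => GLPAlgebra.dia L i (t.eval e)

namespace GLPTerm

variable {β L S : Type*} [LinearOrder β]
  (Adm : ∀ (C : Type x) [BooleanAlgebra C] [GLPAlgebra β L C], (S → C) → Prop)

/-- Equality of values under all valuations that are admissible in the sense of `Adm`. -/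
def setoid : Setoid (GLPTerm β L S) where
  r t₁ t₂ := ∀ (C : Type x) [BooleanAlgebra C] [GLPAlgebra β L C] (e : S → C), Adm C e →
    t₁.eval e = t₂.eval e
  iseqv := ⟨fun _ _ _ _ _ _ => rfl, fun h C _ _ e he => (h C e he).symm,
    fun h h' C _ _ e he => (h C e he).trans (h' C e he)⟩

/-- The term algebra. -/
def Alg : Type _ := Quotient (setoid Adm)

instance : BooleanAlgebra (Alg Adm) where
  le := Quotient.lift₂ (fun t₁ t₂ => ∀ (C : Type x) [BooleanAlgebra C] [GLPAlgebra β L C]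
      (e : S → C), Adm C e → t₁.eval e ≤ t₂.eval e) (by
    intro a₁ b₁ a₂ b₂ h₁ h₂
    refine propext ⟨fun h C _ _ e he => ?_, fun h C _ _ e he => ?_⟩
    · rw [← h₁ C e he, ← h₂ C e he]; exact h C e he
    · rw [h₁ C e he, h₂ C e he]; exact h C e he)
  le_refl := by
    rintro ⟨a⟩ C _ _ e he
    exact le_rfl
  le_trans := by
    rintro ⟨a⟩ ⟨b⟩ ⟨c⟩ h h' C _ _ e he
    exact (h C e he).trans (h' C e he)
  le_antisymm := by
    rintro ⟨a⟩ ⟨b⟩ h h'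
    exact Quotient.sound fun C _ _ e he => le_antisymm (h C e he) (h' C e he)
  sup := Quotient.map₂ .sup fun _ _ h _ _ h' C _ _ e he =>
    congrArg₂ (· ⊔ ·) (h C e he) (h' C e he)
  inf := Quotient.map₂ .inf fun _ _ h _ _ h' C _ _ e he =>
    congrArg₂ (· ⊓ ·) (h C e he) (h' C e he)
  compl := Quotient.map .compl fun _ _ h C _ _ e he => congrArg (·ᶜ) (h C e he)
  top := Quotient.mk _ .top
  bot := Quotient.mk _ .bot
  le_sup_left := by
    rintro ⟨a⟩ ⟨b⟩ C _ _ e he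
    exact le_sup_left
  le_sup_right := by
    rintro ⟨a⟩ ⟨b⟩ C _ _ e he
    exact le_sup_right
  sup_le := by
    rintro ⟨a⟩ ⟨b⟩ ⟨c⟩ h h' C _ _ e he
    exact sup_le (h C e he) (h' C e he)
  inf_le_left := by
    rintro ⟨a⟩ ⟨b⟩ C _ _ e he
    exact inf_le_left
  inf_le_right := by
    rintro ⟨a⟩ ⟨b⟩ C _ _ e he
    exact inf_le_right
  le_inf := by
    rintro ⟨a⟩ ⟨b⟩ ⟨c⟩ h h' C _ _ e he
    exact le_inf (h C e he) (h' C e he)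
  le_sup_inf := by
    rintro ⟨a⟩ ⟨b⟩ ⟨c⟩ C _ _ e he
    exact le_sup_inf
  inf_compl_le_bot := by
    rintro ⟨a⟩ C _ _ e he
    exact BooleanAlgebra.inf_compl_le_bot _
  top_le_sup_compl := by
    rintro ⟨a⟩ C _ _ e he
    exact BooleanAlgebra.top_le_sup_compl _
  le_top := by
    rintro ⟨a⟩ C _ _ e he
    exact le_top
  bot_le := by
    rintro ⟨a⟩ C _ _ e he
    exact bot_le

instance : GLPAlgebra β L (Alg Adm) where
  dia i := Quotient.map (.dia i) fun _ _ h C _ _ e he =>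
    congrArg (GLPAlgebra.dia L i) (h C e he)
  const c := Quotient.mk _ (.cst c)
  dia_bot i := Quotient.sound fun C _ _ e he => GLPAlgebra.dia_bot i
  dia_sup := by
    rintro i ⟨a⟩ ⟨b⟩
    exact Quotient.sound fun C _ _ e he => GLPAlgebra.dia_sup i _ _
  dia_loeb := by
    rintro i ⟨a⟩
    exact Quotient.sound fun C _ _ e he => GLPAlgebra.dia_loeb i _
  dia_anti := by
    rintro i j ⟨a⟩ h C _ _ e he
    exact GLPAlgebra.dia_anti i j _ h
  dia_le_box_dia := by
    rintro i j ⟨a⟩ h C _ _ e he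
    exact GLPAlgebra.dia_le_box_dia i j _ h

variable {Adm}

/-- Evaluation as a homomorphism on the term algebra. -/
def lift {C : Type x} [BooleanAlgebra C] [GLPAlgebra β L C] (e : S → C) (he : Adm C e) :
    GLPHom β L (Alg Adm) C where
  toFun := Quotient.lift (eval e) fun _ _ h => h C e he
  map_sup' := by rintro ⟨a⟩ ⟨b⟩; rfl
  map_inf' := by rintro ⟨a⟩ ⟨b⟩; rfl
  map_top' := rfl
  map_bot' := rfl
  map_dia' := by rintro i ⟨a⟩; rfl
  map_const' _ := rfl

theorem lift_unique {C : Type*} [BooleanAlgebra C] [GLPAlgebra β L C]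
    (h h' : GLPHom β L (Alg Adm) C)
    (H : ∀ s, h.toFun (Quotient.mk _ (.gen s)) = h'.toFun (Quotient.mk _ (.gen s))) : h = h' := by
  let q : GLPTerm β L S → Alg Adm := fun t => Quotient.mk _ t
  have key : ∀ t, h.toBoundedLatticeHom (q t) = h'.toBoundedLatticeHom (q t) := by
    intro t
    induction t with
    | gen s => exact H s
    | cst c => exact (h.map_const' c).trans (h'.map_const' c).symm
    | bot => exact h.map_bot'.trans h'.map_bot'.symm
    | top => exact h.map_top'.trans h'.map_top'.symm
    | inf a b iha ihb =>
      have e : q (a.inf b) = q a ⊓ q b := rfl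
      rw [e, map_inf, map_inf, iha, ihb]
    | sup a b iha ihb =>
      have e : q (a.sup b) = q a ⊔ q b := rfl
      rw [e, map_sup, map_sup, iha, ihb]
    | compl a iha =>
      have e : q a.compl = (q a)ᶜ := rfl
      rw [e, map_compl', map_compl', iha]
    | dia i a iha =>
      exact (h.map_dia' i (q a)).trans
        ((congrArg (GLPAlgebra.dia L i) iha).trans (h'.map_dia' i (q a)).symm)
  have : h.toBoundedLatticeHom = h'.toBoundedLatticeHom := by
    ext ⟨t⟩
    exact key t
  cases h; cases h'; cases this; rfl

end GLPTerm

/-- Every algebra has a free `l`-extension. -/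
theorem exists_isFreeExtension {α β : Type u} {K L : Type v} [LinearOrder α] [LinearOrder β]
    (l : TypeEmbedding α K β L) (A : Type w) [BooleanAlgebra A] [GLPAlgebra α K A] :
    ∃ (F : Type (max u v w)) (_ : BooleanAlgebra F) (_ : GLPAlgebra β L F)
      (e : GLPHom α K A (Puration l F)), IsFreeExtension l e := by
  let Adm : ∀ (C : Type (max u v w)) [BooleanAlgebra C] [GLPAlgebra β L C], (A → C) → Prop :=
    fun C _ _ e => ∃ g : GLPHom α K A (Puration l C), e = g.toFun
  refine ⟨GLPTerm.Alg Adm, inferInstance, inferInstance,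
    { toFun := fun a => (Quotient.mk _ (GLPTerm.gen a) : GLPTerm.Alg Adm)
      map_sup' := ?_
      map_inf' := ?_
      map_top' := ?_
      map_bot' := ?_
      map_dia' := ?_
      map_const' := ?_ }, ?_⟩
  · rintro a b
    refine Quotient.sound ?_
    rintro C _ _ _ ⟨g, rfl⟩
    exact g.map_sup' a b
  · rintro a b
    refine Quotient.sound ?_
    rintro C _ _ _ ⟨g, rfl⟩
    exact g.map_inf' a b
  · refine Quotient.sound ?_
    rintro C _ _ _ ⟨g, rfl⟩
    exact g.map_top'
  · refine Quotient.sound ?_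
    rintro C _ _ _ ⟨g, rfl⟩
    exact g.map_bot'
  · rintro i a
    refine Quotient.sound ?_
    rintro C _ _ _ ⟨g, rfl⟩
    exact g.map_dia' i a
  · rintro c
    refine Quotient.sound ?_
    rintro C _ _ _ ⟨g, rfl⟩
    exact g.map_const' c
  · intro C _ _ g
    refine ⟨GLPTerm.lift (Adm := Adm) g.toFun ⟨g, rfl⟩, fun a => rfl, fun h hh => ?_⟩
    exact GLPTerm.lift_unique _ _ fun a => hh a

/-- Free algebras exist. -/
theorem exists_isFreeGLPAlgebra (α : Type u) [LinearOrder α] (S : Type v) :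
    ∃ (F : Type (max u v)) (_ : BooleanAlgebra F) (_ : GLPAlgebra α Empty F) (e : S → F),
      IsFreeGLPAlgebra α e := by
  let Adm : ∀ (C : Type (max u v)) [BooleanAlgebra C] [GLPAlgebra α Empty C], (S → C) → Prop :=
    fun _ _ _ _ => True
  refine ⟨GLPTerm.Alg Adm, inferInstance, inferInstance, fun s => Quotient.mk _ (.gen s), ?_⟩
  intro C _ _ g
  refine ⟨GLPTerm.lift (Adm := Adm) g trivial, fun s => rfl, fun h hh => ?_⟩
  exact GLPTerm.lift_unique _ _ fun a => hh a

/-! Freeness enters the lemma only through generation: `F` is generated by the image of `A`, so each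
element needs only finitely many of the new operators (`IsFreeExtension.finitelyGeneratedBelow`).
These are adjoined one at a time, in descending order.

The heart is one such step (`exists_subalgebra_comparable`): `S` is linear for `◇ j`, and `i < j`.
Worms `a ⊓ ◇ i (b ⊓ ◇ i ...)` with letters in `S` are pairwise comparable at `i`
(`IsWorm.comparable`), so the elements `◇ i w` form a chain. Hence the joins of elements `a ⊓ p ⊓ (◇
i v)ᶜ` are closed under Boolean operations. By Löb's axiom each of them is `≡ᵢ` to a worm
(`IsNormal.exists_sim_isWorm`), which yields both closure under `◇ i` and linearity at `i`.

For the free `∅`-generated algebra, a new greatest operator, constantly `⊥`, turns it into a free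
extension of the two-element algebra. -/

namespace GLPAlgebra

/-! ### The relations `⊲ᵢ` and `≡ᵢ`. -/

section Basic

variable {β L F : Type*} [LinearOrder β] [BooleanAlgebra F] [GLPAlgebra β L F]

theorem dia_mono (i : β) {x y : F} (h : x ≤ y) : dia L i x ≤ dia L i y := by
  rw [← sup_eq_right, dia_sup, sup_eq_right.2 h]

/-- Löb's axiom for `x ⊔ ◇ x`: the part of it outside `◇ (x ⊔ ◇ x)` lies in `x`, since `◇ x ≤ ◇ (x ⊔
◇ x)`. -/
theorem dia_dia_le (i : β) (x : F) : dia L i (dia L i x) ≤ dia L i x := by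
  have h : (dia L i (x ⊔ dia L i x))ᶜ ⊓ (x ⊔ dia L i x) ≤ x := by
    rw [inf_sup_left]
    refine sup_le inf_le_right ?_
    have : (dia L i (x ⊔ dia L i x))ᶜ ⊓ dia L i x = ⊥ :=
      (disjoint_compl_left.mono_right (dia_mono i le_sup_left)).eq_bot
    exact this.le.trans bot_le
  calc dia L i (dia L i x) ≤ dia L i (x ⊔ dia L i x) := dia_mono i le_sup_right
    _ = dia L i ((dia L i (x ⊔ dia L i x))ᶜ ⊓ (x ⊔ dia L i x)) := (dia_loeb i _).symm
    _ ≤ dia L i x := dia_mono i h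

theorem dia_le_dia_of_le {i j : β} (h : i ≤ j) (x : F) : dia L j x ≤ dia L i x := by
  rcases h.eq_or_lt with rfl | h
  · exact le_rfl
  · exact dia_anti i j x h

theorem eq_bot_of_le_dia {i : β} {x : F} (h : x ≤ dia L i x) : x = ⊥ := by
  have h' : (dia L i x)ᶜ ⊓ x = ⊥ := (disjoint_compl_left.mono_right h).eq_bot
  have := dia_loeb (K := L) i x
  rw [h', dia_bot] at this
  rwa [← this, le_bot_iff] at h

theorem Tri.trans {i : β} {x y z : F} (h : Tri L i x y) (h' : Tri L i y z) : Tri L i x z :=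
  le_trans h' ((dia_mono i h).trans (dia_dia_le i x))

theorem Sim.symm {i : β} {x y : F} (h : Sim L i x y) : Sim L i y x := Eq.symm h

theorem Sim.dia_eq {i : β} {x y : F} (h : Sim L i x y) : dia L i x = dia L i y := by
  have key : ∀ z : F, dia L i (dia L i z ⊔ z) = dia L i z := fun z => by
    rw [← dia_sup, sup_eq_right.2 (dia_dia_le i z)]
  rw [← key x, ← key y, show dia L i x ⊔ x = dia L i y ⊔ y from h]

theorem Sim.le {i : β} {x y : F} (h : Sim L i x y) : x ≤ dia L i y ⊔ y :=
  le_sup_right.trans (show dia L i x ⊔ x = dia L i y ⊔ y from h).le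

/-- The map `x ↦ ◇ x ⊔ x` is a closure operator, by transitivity of `◇`. -/
theorem Sim.of_le {i : β} {x y : F} (h : x ≤ dia L i y ⊔ y) (h' : y ≤ dia L i x ⊔ x) :
    Sim L i x y := by
  have key : ∀ {u v : F}, u ≤ dia L i v ⊔ v → dia L i u ⊔ u ≤ dia L i v ⊔ v := fun {u v} huv =>
    sup_le ((dia_mono i huv).trans (by
      rw [← dia_sup, sup_eq_right.2 (dia_dia_le i v)]; exact le_sup_left)) huv
  exact le_antisymm (key h) (key h')

theorem Tri.of_tri_of_sim {i : β} {x y z : F} (h : Tri L i x y) (h' : Sim L i y z) :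
    Tri L i x z :=
  h'.symm.le.trans (sup_le (Tri.trans h le_rfl) h)

theorem Tri.of_sim_of_tri {i : β} {x y z : F} (h : Sim L i x y) (h' : Tri L i y z) :
    Tri L i x z :=
  le_trans h' h.dia_eq.ge

theorem Tri.of_le {i j : β} (hij : i ≤ j) {x y : F} (h : Tri L j x y) : Tri L i x y :=
  le_trans h (dia_le_dia_of_le hij x)

theorem Sim.of_le_index {i j : β} (hij : i ≤ j) {x y : F} (h : Sim L j x y) : Sim L i x y :=
  Sim.of_le (h.le.trans (sup_le_sup_right (dia_le_dia_of_le hij y) y))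
    (h.symm.le.trans (sup_le_sup_right (dia_le_dia_of_le hij x) x))

variable (L) in
/-- `x` and `y` are comparable in the preorder `⊲ᵢ ∪ ≡ᵢ`. -/
def Comparable (i : β) (x y : F) : Prop := Tri L i x y ∨ Tri L i y x ∨ Sim L i x y

theorem Comparable.symm {i : β} {x y : F} (h : Comparable L i x y) : Comparable L i y x := by
  rcases h with h | h | h
  · exact .inr (.inl h)
  · exact .inl h
  · exact .inr (.inr h.symm)

theorem Comparable.congr {i : β} {x y x' y' : F} (h : Comparable L i x y) (hx : Sim L i x' x)
    (hy : Sim L i y' y) : Comparable L i x' y' := by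
  rcases h with h | h | h
  · exact .inl (.of_sim_of_tri hx (h.of_tri_of_sim hy.symm))
  · exact .inr (.inl (.of_sim_of_tri hy (h.of_tri_of_sim hx.symm)))
  · exact .inr (.inr (hx.trans (h.trans hy.symm)))

theorem Comparable.dia_le_or {i : β} {x y : F} (h : Comparable L i x y) :
    dia L i x ≤ dia L i y ∨ dia L i y ≤ dia L i x := by
  rcases h with h | h | h
  · exact .inr ((dia_mono i h).trans (dia_dia_le i x))
  · exact .inl ((dia_mono i h).trans (dia_dia_le i y))
  · exact .inl h.dia_eq.le

theorem Rel.trans {x y z : F} (h : Rel β L x y) (hyz : Rel β L y z) : Rel β L x z := by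
  obtain ⟨i, h⟩ := h
  obtain ⟨j, hyz⟩ := hyz
  refine ⟨min i j, ?_⟩
  replace h : Tri L (min i j) x y ∨ Sim L (min i j) x y :=
    h.imp (Tri.of_le (min_le_left i j)) (Sim.of_le_index (min_le_left i j))
  replace hyz : Tri L (min i j) y z ∨ Sim L (min i j) y z :=
    hyz.imp (Tri.of_le (min_le_right i j)) (Sim.of_le_index (min_le_right i j))
  rcases h with h | h <;> rcases hyz with hyz | hyz
  · exact .inl (h.trans hyz)
  · exact .inl (h.of_tri_of_sim hyz)
  · exact .inl (.of_sim_of_tri h hyz)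
  · exact .inr (Eq.trans h hyz)

/-- Totality is the only condition in the definition of a linear algebra that is not automatic. -/
theorem IsLinear.of_comparable [Nonempty β] (H : ∀ x y : F, ∃ i : β, Comparable L i x y) :
    IsLinear β L F where
  refl x := ⟨Classical.arbitrary β, .inr rfl⟩
  trans x y z := Rel.trans
  total x y := by
    obtain ⟨i, h | h | h⟩ := H x y
    · exact .inl ⟨i, .inl h⟩
    · exact .inr ⟨i, .inl h⟩
    · exact .inl ⟨i, .inr h⟩
  inter := by
    ext ⟨x, y⟩
    simp only [Set.mem_inter_iff, Set.mem_iUnion, Set.mem_ofPred_eq, Set.mem_singleton_iff,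
      Prod.mk.injEq]
    constructor
    · rintro ⟨⟨i, hi⟩, ⟨j, hj⟩⟩
      replace hi : Tri L (min i j) x y := hi.of_le (min_le_left i j)
      replace hj : Sim L (min i j) x y := hj.of_le_index (min_le_right i j)
      -- At the common index, `x ⊲ y ≡ x` gives `x ⊲ x`, which Löb's axiom allows only for `⊥`.
      have hx : x = ⊥ := eq_bot_of_le_dia (L := L) (hi.of_tri_of_sim hj.symm)
      subst hx
      exact ⟨rfl, le_bot_iff.1 (hi.trans_eq (dia_bot _))⟩
    · rintro ⟨rfl, rfl⟩
      exact ⟨⟨Classical.arbitrary β, bot_le⟩, ⟨Classical.arbitrary β, rfl⟩⟩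

theorem IsLinear.comparable (H : IsLinear β L F) {m : β} (hm : IsBot m) (x y : F) :
    Comparable L m x y := by
  rcases H.total x y with ⟨i, h | h⟩ | ⟨i, h | h⟩
  · exact .inl (h.of_le (hm i))
  · exact .inr (.inr (h.of_le_index (hm i)))
  · exact .inr (.inl (h.of_le (hm i)))
  · exact .inr (.inr (h.of_le_index (hm i)).symm)

end Basic

/-! ### Elements that can be pulled out of an operator. -/

section Stable

variable {β L F : Type*} [LinearOrder β] [BooleanAlgebra F] [GLPAlgebra β L F]

variable (L) in
/-- `p` and its complement are both preserved by the accessibility relation of `◇ k`. -/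
def Stable (k : β) (p : F) : Prop := dia L k p ≤ p ∧ dia L k pᶜ ≤ pᶜ

theorem Stable.compl {k : β} {p : F} (h : Stable L k p) : Stable L k pᶜ :=
  ⟨h.2, by rw [compl_compl]; exact h.1⟩

theorem Stable.inf {k : β} {p q : F} (hp : Stable L k p) (hq : Stable L k q) :
    Stable L k (p ⊓ q) := by
  refine ⟨le_inf ((dia_mono k inf_le_left).trans hp.1) ((dia_mono k inf_le_right).trans hq.1), ?_⟩
  rw [compl_inf, ← dia_sup]
  exact sup_le_sup hp.2 hq.2

theorem stable_top (k : β) : Stable L k (⊤ : F) :=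
  ⟨le_top, by rw [compl_top, dia_bot]⟩

/-- One half is transitivity of `◇ i`; the other is the axiom `◇ i x ≤ □ k (◇ i x)` in
contrapositive form. -/
theorem stable_dia {i k : β} (h : i < k) (x : F) : Stable L k (dia L i x) :=
  ⟨(dia_le_dia_of_le h.le _).trans (dia_dia_le i x),
    le_compl_comm.1 (dia_le_box_dia (K := L) i k x h)⟩

/-- Split `z` along `p`: the piece outside `p` contributes to `◇ k z` only outside `p`. -/
theorem Stable.dia_inf {k : β} {p : F} (h : Stable L k p) (z : F) :
    dia L k (z ⊓ p) = dia L k z ⊓ p := by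
  apply le_antisymm
  · exact le_inf (dia_mono k inf_le_left) ((dia_mono k inf_le_right).trans h.1)
  · have hz : dia L k z ≤ dia L k (z ⊓ p) ⊔ pᶜ := by
      calc dia L k z = dia L k (z ⊓ p) ⊔ dia L k (z ⊓ pᶜ) := by
            rw [dia_sup, ← inf_sup_left, sup_compl_eq_top, inf_top_eq]
        _ ≤ _ := sup_le_sup_left ((dia_mono k inf_le_right).trans h.2) _
    calc dia L k z ⊓ p ≤ (dia L k (z ⊓ p) ⊔ pᶜ) ⊓ p := inf_le_inf_right p hz
      _ ≤ dia L k (z ⊓ p) := by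
        rw [inf_sup_right, compl_inf_eq_bot, sup_bot_eq]; exact inf_le_left

end Stable

/-! ### Worms and normal forms: adjoining one operator. -/

section Worm

variable {β L F : Type*} [LinearOrder β] [BooleanAlgebra F] [GLPAlgebra β L F]

variable (L) in
/-- Words in the operator `◇ i` with letters in the subalgebra `S`. -/
inductive IsWorm (i : β) (S : BooleanSubalgebra F) : F → Prop
  | letter (a : F) : a ∈ S → IsWorm i S a
  | cons (a w : F) : a ∈ S → IsWorm i S w → IsWorm i S (a ⊓ dia L i w)

variable {i j : β} {S : BooleanSubalgebra F}

/-- Each element lies below the other's stable factor, so that factor can be moved through `◇ j`.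
The letters `a`, `b` thus decide the comparison at `j`, which is then weakened to `i`. -/
theorem comparable_inf_of_le {a b p q : F} (hij : i < j) (hp : Stable L j p) (hq : Stable L j q)
    (hab : Comparable L j a b) (hap : a ⊓ p ≤ q) (hbq : b ⊓ q ≤ p) :
    Comparable L i (a ⊓ p) (b ⊓ q) := by
  have tri : ∀ {a b p q : F}, Stable L j p → Tri L j a b → b ⊓ q ≤ p →
      Tri L i (a ⊓ p) (b ⊓ q) := fun {a b p q} hp h hbq =>
    calc b ⊓ q ≤ dia L j a ⊓ p := le_inf (inf_le_left.trans h) hbq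
      _ = dia L j (a ⊓ p) := (hp.dia_inf a).symm
      _ ≤ dia L i (a ⊓ p) := dia_le_dia_of_le hij.le _
  have sim : ∀ {a b p q : F}, Stable L j q → Sim L j a b → a ⊓ p ≤ q →
      a ⊓ p ≤ dia L i (b ⊓ q) ⊔ b ⊓ q := fun {a b p q} hq h hap =>
    calc a ⊓ p ≤ (dia L j b ⊔ b) ⊓ q := le_inf (inf_le_left.trans h.le) hap
      _ = dia L j (b ⊓ q) ⊔ b ⊓ q := by rw [inf_sup_right, hq.dia_inf]
      _ ≤ _ := sup_le_sup_right (dia_le_dia_of_le hij.le _) _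
  rcases hab with h | h | h
  · exact .inl (tri hp h hbq)
  · exact .inr (.inl (tri hq h hap))
  · exact .inr (.inr (.of_le (sim hq h hap) (sim hp h.symm hbq)))

/-- The dichotomy behind the comparison of worms: `u` dominates every worm with tail `◇ i v`, or it
lies below that tail. -/
theorem Comparable.tri_inf_or {u v b : F} (h : Comparable L i u v) :
    Tri L i u (b ⊓ dia L i v) ∨ u ≤ dia L i v := by
  rcases h with h | h | h
  · exact .inl (inf_le_right.trans ((dia_mono i h).trans (dia_dia_le i u)))
  · exact .inr h
  · exact .inl (inf_le_right.trans h.dia_eq.ge)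

/-- Compare each worm with the argument of the other's leading `◇ i`. Unless this settles the
matter, each worm lies below the other's tail, and the first letters decide. A single letter counts
as having tail `⊤`. -/
theorem IsWorm.comparable (hij : i < j)
    (hS : ∀ a ∈ S, ∀ b ∈ S, Comparable L j a b) {u v : F} (hu : IsWorm L i S u)
    (hv : IsWorm L i S v) : Comparable L i u v := by
  induction hu generalizing v with
  | letter a ha =>
    induction hv with
    | letter b hb =>
      simpa using comparable_inf_of_le hij (stable_top j) (stable_top j) (hS a ha b hb)
        le_top le_top
    | cons b v hb hv ihv =>
      rcases ihv.tri_inf_or with h | h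
      · exact .inl h
      · simpa using comparable_inf_of_le hij (stable_top j) (stable_dia hij v) (hS a ha b hb)
          (inf_le_left.trans h) le_top
  | cons a u ha hu ihu =>
    induction hv with
    | letter b hb =>
      rcases (ihu (.letter b hb)).symm.tri_inf_or with h | h
      · exact .inr (.inl h)
      · simpa using comparable_inf_of_le hij (stable_dia hij u) (stable_top j) (hS a ha b hb)
          le_top (inf_le_left.trans h)
    | cons b v hb hv ihv =>
      rcases ihv.tri_inf_or with h | h
      · exact .inl h
      rcases (ihu (.cons b v hb hv)).symm.tri_inf_or with h' | h'
      · exact .inr (.inl h')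
      · exact comparable_inf_of_le hij (stable_dia hij u) (stable_dia hij v) (hS a ha b hb) h h'

theorem isWorm_bot : IsWorm L i S ⊥ := .letter ⊥ S.bot_mem

variable (L) in
/-- The top element and the elements `◇ i w` for worms `w`. -/
def IsTail (i : β) (S : BooleanSubalgebra F) (p : F) : Prop :=
  p = ⊤ ∨ ∃ w, IsWorm L i S w ∧ p = dia L i w

variable (L) in
/-- Finite joins of elements `a ⊓ p ⊓ (◇ i v)ᶜ` with `a ∈ S`, a tail `p` and a worm `v`. -/
inductive IsNormal (i : β) (S : BooleanSubalgebra F) : F → Prop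
  | basic (a p v : F) : a ∈ S → IsTail L i S p → IsWorm L i S v →
      IsNormal i S (a ⊓ (p ⊓ (dia L i v)ᶜ))
  | sup (x y : F) : IsNormal i S x → IsNormal i S y → IsNormal i S (x ⊔ y)

theorem IsTail.isWorm_inf {p a : F} (hp : IsTail L i S p) (ha : a ∈ S) :
    IsWorm L i S (a ⊓ p) := by
  rcases hp with rfl | ⟨w, hw, rfl⟩
  · rw [inf_top_eq]; exact .letter a ha
  · exact .cons a w ha hw

theorem IsTail.stable {k : β} (h : i < k) {p : F} (hp : IsTail L i S p) : Stable L k p := by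
  rcases hp with rfl | ⟨w, -, rfl⟩
  · exact stable_top k
  · exact stable_dia h w

theorem isNormal_of_mem {a : F} (ha : a ∈ S) : IsNormal L i S a := by
  have := IsNormal.basic (L := L) (i := i) a ⊤ ⊥ ha (.inl rfl) isWorm_bot
  rwa [dia_bot, compl_bot, inf_top_eq, inf_top_eq] at this

theorem isNormal_dia {w : F} (hw : IsWorm L i S w) : IsNormal L i S (dia L i w) := by
  have := IsNormal.basic (L := L) (i := i) ⊤ _ ⊥ S.top_mem (.inr ⟨w, hw, rfl⟩) isWorm_bot
  rwa [dia_bot, compl_bot, inf_top_eq, top_inf_eq] at this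

theorem isNormal_compl_dia {w : F} (hw : IsWorm L i S w) : IsNormal L i S (dia L i w)ᶜ := by
  have := IsNormal.basic (L := L) (i := i) ⊤ ⊤ w S.top_mem (.inl rfl) hw
  rwa [top_inf_eq, top_inf_eq] at this

/-- The factors built with `◇ i` are stable for `◇ k`, so `◇ k` acts on the letter alone. -/
theorem IsNormal.dia_of_lt {k : β} (hik : i < k) (hS : ∀ a ∈ S, dia L k a ∈ S) {x : F}
    (hx : IsNormal L i S x) : IsNormal L i S (dia L k x) := by
  induction hx with
  | basic a p v ha hp hv =>
    rw [((hp.stable hik).inf (stable_dia hik v).compl).dia_inf]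
    exact .basic _ p v (hS a ha) hp hv
  | sup x y _ _ ihx ihy =>
    rw [← dia_sup]
    exact .sup _ _ ihx ihy

theorem IsTail.inf (hij : i < j) (hS : ∀ a ∈ S, ∀ b ∈ S, Comparable L j a b) {p q : F}
    (hp : IsTail L i S p) (hq : IsTail L i S q) : IsTail L i S (p ⊓ q) := by
  rcases hp with rfl | ⟨u, hu, rfl⟩
  · rwa [top_inf_eq]
  rcases hq with rfl | ⟨v, hv, rfl⟩
  · rw [inf_top_eq]; exact .inr ⟨u, hu, rfl⟩
  rcases (hu.comparable hij hS hv).dia_le_or with h | h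
  · exact .inr ⟨u, hu, inf_eq_left.2 h⟩
  · exact .inr ⟨v, hv, inf_eq_right.2 h⟩

theorem IsNormal.inf (hij : i < j) (hS : ∀ a ∈ S, ∀ b ∈ S, Comparable L j a b) {x y : F}
    (hx : IsNormal L i S x) (hy : IsNormal L i S y) : IsNormal L i S (x ⊓ y) := by
  induction hx with
  | sup x x' _ _ ih ih' => rw [inf_sup_right]; exact .sup _ _ ih ih'
  | basic a p v ha hp hv =>
    induction hy with
    | sup y y' _ _ ih ih' => rw [inf_sup_left]; exact .sup _ _ ih ih'
    | basic b q w hb hq hw =>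
      rw [inf_inf_inf_comm, inf_inf_inf_comm p, ← compl_sup]
      have hpq := hp.inf hij hS hq
      -- The elements `◇ i w` form a chain, so two negated factors merge into one.
      rcases (hv.comparable hij hS hw).dia_le_or with h | h
      · rw [sup_eq_right.2 h]; exact .basic _ _ w (S.infClosed ha hb) hpq hw
      · rw [sup_eq_left.2 h]; exact .basic _ _ v (S.infClosed ha hb) hpq hv

theorem IsNormal.compl (hij : i < j) (hS : ∀ a ∈ S, ∀ b ∈ S, Comparable L j a b) {x : F}
    (hx : IsNormal L i S x) : IsNormal L i S xᶜ := by
  induction hx with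
  | sup x y _ _ ihx ihy => rw [compl_sup]; exact ihx.inf hij hS ihy
  | basic a p v ha hp hv =>
    rw [compl_inf, compl_inf, compl_compl]
    refine .sup _ _ (isNormal_of_mem (S.compl_mem' ha)) (.sup _ _ ?_ (isNormal_dia hv))
    rcases hp with rfl | ⟨w, hw, rfl⟩
    · rw [compl_top]; exact isNormal_of_mem S.bot_mem
    · exact isNormal_compl_dia hw

/-- An element between `u ⊓ (◇ i u)ᶜ` and `u` has the same closure as `u`. -/
theorem sim_of_inf_compl_dia_le {x u : F} (h : u ⊓ (dia L i u)ᶜ ≤ x) (hxu : x ≤ u) :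
    Sim L i x u := by
  refine .of_le (hxu.trans le_sup_right) ?_
  -- By Löb's axiom, `u ⊓ (◇ i u)ᶜ` already has the same `◇ i` as `u`.
  have hd : dia L i u ≤ dia L i x := by
    rw [← dia_loeb i u, inf_comm]; exact dia_mono i h
  calc u = u ⊓ dia L i u ⊔ u ⊓ (dia L i u)ᶜ := by
        rw [← inf_sup_left, sup_compl_eq_top, inf_top_eq]
    _ ≤ dia L i x ⊔ x := sup_le_sup (inf_le_right.trans hd) h

/-- If `v ⊲ u`, nothing of `u` survives. Otherwise `◇ i v ≤ ◇ i u`, so the part of `u` that carries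
its `◇ i` remains. -/
theorem Comparable.sim_inf_compl_dia {u v : F} (h : Comparable L i u v) :
    u ⊓ (dia L i v)ᶜ = ⊥ ∨ Sim L i (u ⊓ (dia L i v)ᶜ) u := by
  have key : dia L i v ≤ dia L i u → Sim L i (u ⊓ (dia L i v)ᶜ) u := fun h =>
    sim_of_inf_compl_dia_le (inf_le_inf_left u (compl_le_compl h)) inf_le_left
  rcases h with h | h | h
  · exact .inr (key ((dia_mono i h).trans (dia_dia_le i u)))
  · exact .inl (disjoint_compl_right.mono_left h).eq_bot
  · exact .inr (key h.dia_eq.ge)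

theorem Comparable.sim_sup {u v : F} (h : Comparable L i u v) :
    Sim L i (u ⊔ v) u ∨ Sim L i (u ⊔ v) v := by
  rcases h with h | h | h
  · exact .inl (.of_le (sup_le le_sup_right (le_trans h le_sup_left)) (le_sup_left.trans le_sup_right))
  · exact .inr (.of_le (sup_le (le_trans h le_sup_left) le_sup_right)
      (le_sup_right.trans le_sup_right))
  · exact .inl (.of_le (sup_le le_sup_right h.symm.le) (le_sup_left.trans le_sup_right))

theorem Sim.sup {x y u v : F} (h : Sim L i x u) (h' : Sim L i y v) :
    Sim L i (x ⊔ y) (u ⊔ v) := by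
  unfold Sim at *
  rw [← dia_sup, ← dia_sup, sup_sup_sup_comm, h, h', sup_sup_sup_comm]

/-- Removing `◇ i v` from the worm `a ⊓ p` leaves `⊥` or something equivalent to that worm; a join
is equivalent to its dominating member. -/
theorem IsNormal.exists_sim_isWorm (hij : i < j) (hS : ∀ a ∈ S, ∀ b ∈ S, Comparable L j a b)
    {x : F} (hx : IsNormal L i S x) : ∃ w, IsWorm L i S w ∧ Sim L i x w := by
  induction hx with
  | basic a p v ha hp hv =>
    have hu := hp.isWorm_inf ha
    rw [← inf_assoc]
    rcases (hu.comparable hij hS hv).sim_inf_compl_dia with h | h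
    · exact ⟨⊥, isWorm_bot, by rw [h]; rfl⟩
    · exact ⟨_, hu, h⟩
  | sup x y _ _ ihx ihy =>
    obtain ⟨u, hu, hxu⟩ := ihx
    obtain ⟨v, hv, hyv⟩ := ihy
    rcases (hu.comparable hij hS hv).sim_sup with h | h
    · exact ⟨u, hu, (hxu.sup hyv).trans h⟩
    · exact ⟨v, hv, (hxu.sup hyv).trans h⟩

/-- A subalgebra that is linear with respect to `◇ j` extends to one that is closed under `◇ i`
and linear with respect to `◇ i`, where `i < j`. -/
theorem exists_subalgebra_comparable (hij : i < j)
    (hS : ∀ a ∈ S, ∀ b ∈ S, Comparable L j a b) :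
    ∃ N : BooleanSubalgebra F, S ≤ N ∧ (∀ x ∈ N, dia L i x ∈ N) ∧
      (∀ k, i < k → (∀ a ∈ S, dia L k a ∈ S) → ∀ x ∈ N, dia L k x ∈ N) ∧
      ∀ x ∈ N, ∀ y ∈ N, Comparable L i x y := by
  refine ⟨{ carrier := {x | IsNormal L i S x}
            supClosed' := fun x hx y hy => .sup x y hx hy
            infClosed' := fun x hx y hy => hx.inf hij hS hy
            compl_mem' := fun hx => hx.compl hij hS
            bot_mem' := isNormal_of_mem S.bot_mem },
    fun a ha => isNormal_of_mem ha, fun x hx => ?_, fun k hik hk x hx => hx.dia_of_lt hik hk,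
    fun x hx y hy => ?_⟩
  · obtain ⟨w, hw, h⟩ := IsNormal.exists_sim_isWorm hij hS hx
    rw [h.dia_eq]
    exact isNormal_dia hw
  · obtain ⟨u, hu, hxu⟩ := IsNormal.exists_sim_isWorm hij hS hx
    obtain ⟨v, hv, hyv⟩ := IsNormal.exists_sim_isWorm hij hS hy
    exact (hu.comparable hij hS hv).congr hxu hyv

end Worm

end GLPAlgebra

open GLPAlgebra

/-! ### Generation of free extensions. -/

section Generation

variable {β L : Type*} [LinearOrder β] {F : Type x} [BooleanAlgebra F] [GLPAlgebra β L F]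

/-- A Boolean subalgebra that contains the constants and is closed under all operators `◇ i` is a
GLP-algebra. -/
abbrev BooleanSubalgebra.glpAlgebra (U : BooleanSubalgebra F)
    (hdia : ∀ (i : β), ∀ x ∈ U, dia L i x ∈ U) (hconst : ∀ c : L, const β c ∈ U) :
    GLPAlgebra β L U where
  dia i x := ⟨dia L i (x : F), hdia i x x.2⟩
  const c := ⟨const β c, hconst c⟩
  dia_bot i := Subtype.ext (dia_bot i)
  dia_sup i x y := Subtype.ext (dia_sup i (x : F) y)
  dia_loeb i x := Subtype.ext (dia_loeb i (x : F))
  dia_anti i j x h := dia_anti (K := L) i j (x : F) h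
  dia_le_box_dia i j x h := dia_le_box_dia (K := L) i j (x : F) h

variable {α K : Type*} [LinearOrder α] {l : TypeEmbedding α K β L} {A : Type*} [BooleanAlgebra A]
  [GLPAlgebra α K A] {e : GLPHom α K A (Puration l F)}

/-- A free extension is generated by the algebra that it extends. -/
theorem IsFreeExtension.mem_of_closed (he : IsFreeExtension l e) (U : BooleanSubalgebra F)
    (hdia : ∀ (i : β), ∀ x ∈ U, dia L i x ∈ U) (hconst : ∀ c : L, const β c ∈ U)
    (hA : ∀ a : A, (e.toFun a : F) ∈ U) (x : F) : x ∈ U := by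
  let _ := U.glpAlgebra hdia hconst
  let g : GLPHom α K A (Puration l U) :=
    { toFun := fun a => (⟨e.toFun a, hA a⟩ : U)
      map_sup' := fun a b => Subtype.ext (e.map_sup' a b)
      map_inf' := fun a b => Subtype.ext (e.map_inf' a b)
      map_top' := Subtype.ext e.map_top'
      map_bot' := Subtype.ext e.map_bot'
      map_dia' := fun i a => Subtype.ext (e.map_dia' i a)
      map_const' := fun c => Subtype.ext (e.map_const' c) }
  obtain ⟨h, hh, -⟩ := he U g
  let k : GLPHom β L F F :=
    { toFun := fun y => (h.toFun y : F)
      map_sup' := fun a b => congrArg Subtype.val (h.map_sup' a b)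
      map_inf' := fun a b => congrArg Subtype.val (h.map_inf' a b)
      map_top' := congrArg Subtype.val h.map_top'
      map_bot' := congrArg Subtype.val h.map_bot'
      map_dia' := fun i a => congrArg Subtype.val (h.map_dia' i a)
      map_const' := fun c => congrArg Subtype.val (h.map_const' c) }
  let one : GLPHom β L F F :=
    { BoundedLatticeHom.id F with
      map_dia' := fun _ _ => rfl
      map_const' := fun _ => rfl }
  -- The retraction onto `U`, followed by the inclusion, agrees with the identity on the image of
  -- `A`.
  have hk : k = one := (he F e).unique (fun a => congrArg Subtype.val (hh a)) fun a => rfl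
  have hx : (h.toFun x : F) = x := congrArg (fun k' : GLPHom β L F F => k'.toFun x) hk
  rw [← hx]
  exact (h.toFun x).2

end Generation

/-! ### Linearity of free extensions. -/

section FreeExtension

variable {α K β L : Type*} [LinearOrder α] [LinearOrder β] {l : TypeEmbedding α K β L}
  {A : Type*} [BooleanAlgebra A] [GLPAlgebra α K A] {F : Type x} [BooleanAlgebra F]
  [GLPAlgebra β L F] (e : GLPHom α K A (Puration l F))

/-- The image of a homomorphism into a puration. -/
def GLPHom.rangeSubalgebra : BooleanSubalgebra F where
  carrier := Set.range (fun a => (e.toFun a : F))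
  supClosed' := by
    rintro _ ⟨a, rfl⟩ _ ⟨b, rfl⟩
    exact ⟨a ⊔ b, e.map_sup' a b⟩
  infClosed' := by
    rintro _ ⟨a, rfl⟩ _ ⟨b, rfl⟩
    exact ⟨a ⊓ b, e.map_inf' a b⟩
  compl_mem' := by
    rintro _ ⟨a, rfl⟩
    exact ⟨aᶜ, map_compl' e.toBoundedLatticeHom a⟩
  bot_mem' := ⟨⊥, e.map_bot'⟩

theorem GLPHom.dia_mem_rangeSubalgebra (i : α) {x : F} (hx : x ∈ e.rangeSubalgebra) :
    dia L (l.idx i) x ∈ e.rangeSubalgebra := by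
  obtain ⟨a, rfl⟩ := hx
  exact ⟨dia K i a, e.map_dia' i a⟩

theorem GLPHom.comparable_map (i : α) {a b : A} (h : Comparable K i a b) :
    Comparable (F := F) L (l.idx i) (e.toFun a) (e.toFun b) := by
  have tri : ∀ {a b : A}, Tri K i a b → Tri (X := F) L (l.idx i) (e.toFun a) (e.toFun b) :=
    fun {a b} h => (OrderHomClass.mono e.toBoundedLatticeHom h).trans (e.map_dia' i a).le
  have cl : ∀ a : A, dia (X := F) L (l.idx i) (e.toFun a) ⊔ (e.toFun a : F) = e.toFun (dia K i a ⊔ a) :=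
    fun a => ((e.map_sup' _ _).trans (congrArg (· ⊔ e.toFun a) (e.map_dia' i a))).symm
  rcases h with h | h | h
  · exact .inl (tri h)
  · exact .inr (.inl (tri h))
  · exact .inr (.inr ((cl a).trans ((congrArg e.toFun h).trans (cl b).symm)))

/-- Adding finitely many operators below the given ones to the image of a linear algebra yields
linear subalgebras. -/
theorem GLPHom.exists_subalgebra_comparable {m : α} (hm : IsBot m) (hA : IsLinear α K A)
    (J : Finset β) (hJ : ∀ k ∈ J, k < l.idx m) :
    ∃ (N : BooleanSubalgebra F) (j : β), e.rangeSubalgebra ≤ N ∧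
      (j = l.idx m ∨ j ∈ J) ∧
      (∀ i : α, ∀ x ∈ N, dia L (l.idx i) x ∈ N) ∧ (∀ k ∈ J, ∀ x ∈ N, dia L k x ∈ N) ∧
      ∀ x ∈ N, ∀ y ∈ N, Comparable L j x y := by
  -- Each inserted `k` is below all earlier indices, hence below the index `j` at which linearity is
  -- already known.
  induction J using Finset.induction_on_min with
  | empty =>
    refine ⟨e.rangeSubalgebra, l.idx m, le_rfl, .inl rfl,
      fun i x hx => e.dia_mem_rangeSubalgebra i hx, by simp, ?_⟩
    rintro _ ⟨a, rfl⟩ _ ⟨b, rfl⟩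
    exact e.comparable_map m (hA.comparable hm a b)
  | insert k J hk ih =>
    obtain ⟨S, j, hS, hj, hSl, hSJ, hSc⟩ :=
      ih fun k' hk' => hJ k' (Finset.mem_insert_of_mem hk')
    have hkm : k < l.idx m := hJ k (Finset.mem_insert_self k J)
    have hkj : k < j := by
      rcases hj with rfl | hj
      · exact hkm
      · exact hk j hj
    obtain ⟨N, hSN, hNk, hN, hNc⟩ := GLPAlgebra.exists_subalgebra_comparable hkj hSc
    refine ⟨N, k, hS.trans hSN, .inr (Finset.mem_insert_self k J), fun i => ?_, ?_, hNc⟩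
    · exact hN _ (hkm.trans_le (l.strictMono_idx.monotone (hm i))) (hSl i)
    · intro k' hk'
      rcases Finset.mem_insert.1 hk' with rfl | hk'
      · exact hNk
      · exact fun x hx => hN k' (hk k' hk') (hSJ k' hk') x hx

/-- `x` is generated by the image of `e`, the operators `◇ (l.idx i)` and finitely many operators
`◇ k` with `k < n`. -/
def GLPHom.FinitelyGeneratedBelow (n : β) (x : F) : Prop :=
  ∃ J : Finset β, (∀ k ∈ J, k < n) ∧ ∀ N : BooleanSubalgebra F,
    e.rangeSubalgebra ≤ N → (∀ i : α, ∀ x ∈ N, dia L (l.idx i) x ∈ N) →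
    (∀ k ∈ J, ∀ x ∈ N, dia L k x ∈ N) → x ∈ N

variable {e}

theorem GLPHom.FinitelyGeneratedBelow.map₂ {n : β} {f : F → F → F}
    (hf : ∀ (N : BooleanSubalgebra F), ∀ x ∈ N, ∀ y ∈ N, f x y ∈ N) {x y : F}
    (hx : e.FinitelyGeneratedBelow n x) (hy : e.FinitelyGeneratedBelow n y) :
    e.FinitelyGeneratedBelow n (f x y) := by
  classical
  obtain ⟨J, hJ, hx⟩ := hx
  obtain ⟨J', hJ', hy⟩ := hy
  exact ⟨J ∪ J', fun k hk => (Finset.mem_union.1 hk).elim (hJ k) (hJ' k),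
    fun N h₁ h₂ h₃ => hf N x (hx N h₁ h₂ fun k hk => h₃ k (Finset.mem_union_left J' hk)) y
      (hy N h₁ h₂ fun k hk => h₃ k (Finset.mem_union_right J hk))⟩

/-- Every element of a free extension is generated with finitely many new operators. -/
theorem IsFreeExtension.finitelyGeneratedBelow (hl : Function.Surjective l.cst) {n : β}
    (hn : ∀ k : β, k < n ∨ k ∈ Set.range l.idx) (he : IsFreeExtension l e) (x : F) :
    e.FinitelyGeneratedBelow n x := by
  classical
  refine he.mem_of_closed
    { carrier := {x | e.FinitelyGeneratedBelow n x}
      supClosed' := fun x hx y hy => hx.map₂ (fun N x hx y hy => N.supClosed hx hy) hy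
      infClosed' := fun x hx y hy => hx.map₂ (fun N x hx y hy => N.infClosed hx hy) hy
      compl_mem' := ?_
      bot_mem' := ⟨∅, by simp, fun N _ _ _ => N.bot_mem⟩ } ?_ ?_ ?_ x
  · rintro x ⟨J, hJ, hx⟩
    exact ⟨J, hJ, fun N h₁ h₂ h₃ => N.compl_mem' (hx N h₁ h₂ h₃)⟩
  · rintro k x ⟨J, hJ, hx⟩
    rcases hn k with hk | ⟨i, rfl⟩
    · refine ⟨insert k J, fun k' hk' => ?_, fun N h₁ h₂ h₃ => ?_⟩
      · rcases Finset.mem_insert.1 hk' with rfl | hk'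
        · exact hk
        · exact hJ k' hk'
      · exact h₃ k (Finset.mem_insert_self k J) x
          (hx N h₁ h₂ fun k' hk' => h₃ k' (Finset.mem_insert_of_mem hk'))
    · exact ⟨J, hJ, fun N h₁ h₂ h₃ => h₂ i x (hx N h₁ h₂ h₃)⟩
  · intro c
    obtain ⟨c, rfl⟩ := hl c
    exact ⟨∅, by simp, fun N h₁ _ _ => h₁ ⟨const α c, e.map_const' c⟩⟩
  · exact fun a => ⟨∅, by simp, fun N h₁ _ _ => h₁ ⟨a, rfl⟩⟩

/-- Two given elements need only finitely many new operators between them, so both lie in one of the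
linear subalgebras. Finality ensures that every new index is below `l.idx m`. -/
theorem IsFreeExtension.isLinear (hl : l.IsFinal) (hA : IsLinear α K A)
    (he : IsFreeExtension l e) : IsLinear β L F := by
  classical
  obtain ⟨m, hm⟩ := hl.normal
  have : Nonempty β := ⟨l.idx m⟩
  have hm' : ∀ k : β, k < l.idx m ∨ k ∈ Set.range l.idx := fun k =>
    (lt_or_ge k (l.idx m)).imp_right fun h => hl.isUpperSet_range h ⟨m, rfl⟩
  refine .of_comparable fun x y => ?_
  obtain ⟨J, hJ, hx⟩ := he.finitelyGeneratedBelow hl.bijective_cst.2 hm' x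
  obtain ⟨J', hJ', hy⟩ := he.finitelyGeneratedBelow hl.bijective_cst.2 hm' y
  obtain ⟨N, j, h₁, -, h₂, h₃, hN⟩ := e.exists_subalgebra_comparable hm hA (J ∪ J')
    fun k hk => (Finset.mem_union.1 hk).elim (hJ k) (hJ' k)
  exact ⟨j, hN x (hx N h₁ h₂ fun k hk => h₃ k (Finset.mem_union_left J' hk)) y
    (hy N h₁ h₂ fun k hk => h₃ k (Finset.mem_union_right J hk))⟩

end FreeExtension

/-! ### The free algebra without generators. -/

section FreeAlgebra

/-- An algebra with an additional greatest operator that is constantly `⊥`. -/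
abbrev GLPAlgebra.withTop {α K X : Type*} [LinearOrder α] [BooleanAlgebra X] [GLPAlgebra α K X] :
    GLPAlgebra (WithTop α) K X where
  dia i x := i.recTopCoe ⊥ fun j => dia K j x
  const c := const α c
  dia_bot i := by
    induction i using WithTop.recTopCoe with
    | top => rfl
    | coe i => exact dia_bot i
  dia_sup i x y := by
    induction i using WithTop.recTopCoe with
    | top => exact sup_idem _
    | coe i => exact dia_sup i x y
  dia_loeb i x := by
    induction i using WithTop.recTopCoe with
    | top => rfl
    | coe i => exact dia_loeb i x
  dia_anti i j x h := by
    induction j using WithTop.recTopCoe with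
    | top => exact bot_le
    | coe j =>
      lift i to α using (h.trans_le le_top).ne
      exact dia_anti i j x (WithTop.coe_lt_coe.1 h)
  dia_le_box_dia i j x h := by
    induction j using WithTop.recTopCoe with
    | top => exact le_top.trans compl_bot.ge
    | coe j =>
      lift i to α using (h.trans_le le_top).ne
      exact dia_le_box_dia i j x (WithTop.coe_lt_coe.1 h)

/-- A Boolean algebra as a GLP-algebra with one operator that is constantly `⊥`. -/
abbrev GLPAlgebra.trivial (X : Type*) [BooleanAlgebra X] : GLPAlgebra PUnit.{u + 1} Empty X where
  dia _ _ := ⊥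
  const := Empty.elim
  dia_bot _ := rfl
  dia_sup _ _ _ := sup_idem _
  dia_loeb _ _ := rfl
  dia_anti _ _ _ h := (lt_irrefl _ h).elim
  dia_le_box_dia _ _ _ h := (lt_irrefl _ h).elim

theorem GLPAlgebra.isLinear_trivial_bool :
    @IsLinear PUnit.{u + 1} Empty _ Bool _ (GLPAlgebra.trivial.{u} Bool) := by
  let _ := GLPAlgebra.trivial.{u} Bool
  refine .of_comparable fun x y => ⟨PUnit.unit, ?_⟩
  cases x <;> cases y
  · exact .inl le_rfl
  · exact .inr (.inl le_rfl)
  · exact .inl le_rfl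
  · exact .inr (.inr rfl)

/-- The embedding of the greatest index. -/
def TypeEmbedding.top (α : Type u) [LinearOrder α] :
    TypeEmbedding PUnit.{u + 1} Empty (WithTop α) Empty where
  idx _ := ⊤
  cst := id
  strictMono_idx _ _ h := (lt_irrefl _ h).elim
  injective_cst := Function.injective_id

/-- The embedding of all indices but the greatest one. -/
def TypeEmbedding.coeWithTop (α K : Type*) [LinearOrder α] :
    TypeEmbedding α K (WithTop α) K where
  idx := (↑)
  cst := id
  strictMono_idx := WithTop.coe_strictMono
  injective_cst := Function.injective_id

theorem TypeEmbedding.isFinal_top (α : Type u) [LinearOrder α] :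
    (TypeEmbedding.top α).IsFinal where
  normal := ⟨PUnit.unit, fun _ => le_rfl⟩
  bijective_cst := Function.bijective_id
  isUpperSet_range := by
    rintro _ b h ⟨i, rfl⟩
    exact ⟨i, (top_le_iff.1 h).symm⟩

theorem IsFreeGLPAlgebra.isLinear {α : Type u} [LinearOrder α] [Nonempty α] {F : Type u}
    [BooleanAlgebra F] [GLPAlgebra α Empty F]
    (hF : IsFreeGLPAlgebra α (Empty.elim : Empty → F)) : IsLinear α Empty F := by
  let _ : GLPAlgebra (WithTop α) Empty F := GLPAlgebra.withTop
  let _ := GLPAlgebra.trivial.{u} Bool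
  let l := TypeEmbedding.top α
  let e : GLPHom PUnit.{u + 1} Empty Bool (Puration l F) :=
    { toFun := fun b => (cond b ⊤ ⊥ : F)
      map_sup' := by
        rintro (_ | _) (_ | _)
        · exact (sup_idem (⊥ : F)).symm
        · exact (bot_sup_eq (⊤ : F)).symm
        · exact (sup_bot_eq (⊤ : F)).symm
        · exact (sup_idem (⊤ : F)).symm
      map_inf' := by
        rintro (_ | _) (_ | _)
        · exact (inf_idem (⊥ : F)).symm
        · exact (inf_top_eq (⊥ : F)).symm
        · exact (inf_bot_eq (⊤ : F)).symm
        · exact (inf_idem (⊤ : F)).symm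
      map_top' := rfl
      map_bot' := rfl
      map_dia' := fun _ _ => rfl
      map_const' := nofun }
  have he : IsFreeExtension l e := by
    intro C _ _ g
    let l' := TypeEmbedding.coeWithTop α Empty
    -- Since `◇ ⊤ = ⊥` in `Bool`, the homomorphism `g` forces the greatest operator of `C` to
    -- vanish. So `C` carries no more structure than its reduct to `α`, where the universal property
    -- of `F` applies.
    have hC : ∀ y : C, dia Empty (⊤ : WithTop α) y = ⊥ := fun y => by
      have htop : dia Empty (⊤ : WithTop α) (⊤ : C) = ⊥ :=
        (congrArg (dia (X := C) Empty (⊤ : WithTop α)) g.map_top'.symm).trans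
          ((g.map_dia' PUnit.unit ⊤).symm.trans g.map_bot')
      exact le_bot_iff.1 ((dia_mono _ le_top).trans htop.le)
    obtain ⟨h, -, huniq⟩ := hF (Puration l' C) Empty.elim
    refine ⟨{ toFun := h.toFun
              map_sup' := h.map_sup'
              map_inf' := h.map_inf'
              map_top' := h.map_top'
              map_bot' := h.map_bot'
              map_dia' := ?_
              map_const' := nofun }, ?_, ?_⟩
    · intro i x
      induction i using WithTop.recTopCoe with
      | top => exact h.map_bot'.trans (hC _).symm
      | coe i => exact h.map_dia' i x
    · rintro (_ | _)
      · exact h.map_bot'.trans g.map_bot'.symm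
      · exact h.map_top'.trans g.map_top'.symm
    · intro k _
      let k' : GLPHom α Empty F (Puration l' C) :=
        { toFun := k.toFun
          map_sup' := k.map_sup'
          map_inf' := k.map_inf'
          map_top' := k.map_top'
          map_bot' := k.map_bot'
          map_dia' := fun i x => k.map_dia' i x
          map_const' := nofun }
      have hk : k' = h := huniq k' nofun
      rw [← hk]
  have hlin : IsLinear (WithTop α) Empty F :=
    IsFreeExtension.isLinear (TypeEmbedding.isFinal_top α) GLPAlgebra.isLinear_trivial_bool he
  -- At the added index, `x ⊲ y` means `y = ⊥` and `x ≡ y` means `x = y`; either gives comparability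
  -- at any index of `α`.
  have hRel : ∀ x y : F, Rel (WithTop α) Empty x y → ∃ i : α, Comparable Empty i x y := by
    rintro x y ⟨i, hi⟩
    induction i using WithTop.recTopCoe with
    | top =>
      refine ⟨Classical.arbitrary α, ?_⟩
      rcases hi with hi | hi
      · exact .inl (le_trans hi bot_le)
      · have hxy : x = y := (bot_sup_eq x).symm.trans (Eq.trans hi (bot_sup_eq y))
        exact .inr (.inr (congrArg (fun z => dia Empty _ z ⊔ z) hxy))
    | coe i => exact ⟨i, hi.elim .inl fun h => .inr (.inr h)⟩
  refine .of_comparable fun x y => ?_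
  rcases hlin.total x y with h | h
  · exact hRel x y h
  · obtain ⟨i, hi⟩ := hRel y x h
    exact ⟨i, hi.symm⟩

end FreeAlgebra

theorem mainTheorem6 :
    (∀ (α β : Type u) (K L : Type v) [LinearOrder α] [LinearOrder β]
      (l : TypeEmbedding α K β L), l.IsFinal →
      ∀ (A : Type w) [BooleanAlgebra A] [GLPAlgebra α K A], GLPAlgebra.IsLinear α K A →
      ∀ (F : Type (max u v w)) [BooleanAlgebra F] [GLPAlgebra β L F]
        (e : GLPHom α K A (Puration l F)), IsFreeExtension l e → GLPAlgebra.IsLinear β L F) ∧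
    (∀ (α : Type u) [LinearOrder α] [Nonempty α]
      (F : Type u) [BooleanAlgebra F] [GLPAlgebra α Empty F],
      IsFreeGLPAlgebra α (Empty.elim : Empty → F) → GLPAlgebra.IsLinear α Empty F) := by
  refine ⟨?_, ?_⟩
  · intro α β K L _ _ l hl A _ _ hA F _ _ e he
    exact he.isLinear hl hA
  · intro α _ _ F _ _ hF
    exact hF.isLinear
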